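/- Let $E$ be a complex Banach space, $E^*$ its (complex) dual, and $E_{\mathbb R}$ the space $E$ regarded as a real Banach space. For $z^*\in E^*$, let $\mathfrak{Re}\,z^*\in (E_{\mathbb R})^*$ be its real part, $z\mapsto \mathfrak{Re}\,(z^*(z))$. Let $\mathrm{FBL}[E_{\mathbb R}]$ be the free Banach lattice generated by $E_{\mathbb R}$: with $$\|f\|=\sup\Big\{\sum_{i=1}^n|f(x_i^*)| : n\in\mathbb N,\ x_1^*,\dots,x_n^*\in (E_{\mathbb R})^*,\ \sup_{\|x\|\le 1}\sum_{i=1}^n|x_i^*(x)|\le 1\Big\},$$ it is the closed sublattice, generated by the evaluations $\delta_x(x^*)=x^*(x)$ $(x\in E)$, of the Banach lattice (with pointwise order) of all positively homogeneous functions $f:(E_{\mathbb R})^*\to\mathbb R$ with $\|f\|<\infty$. Let $\mathrm{FBL}_{\mathbb C}[E]=\mathrm{FBL}[E_{\mathbb R}]\oplus i\,\mathrm{FBL}[E_{\mathbb R}]$ be the free complex Banach lattice generated by $E$, with the norm $$\|f+ig\|_{\mathrm{FBL}_{\mathbb C}[E]}=\sup\Big\{\sum_{j=1}^m|(f+ig)(\mathfrak{Re}\,z_j^*)|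 : m\in\mathbb N,\ z_1^*,\dots,z_m^*\in E^*,\ \sup_{\|z\|\le 1}\sum_{j=1}^m|z_j^*(z)|\le 1\Big\}.$$ A functional $\varphi\in \mathrm{FBL}_{\mathbb C}[E]^*$ is called a lattice homomorphism if it is the complexification of a real lattice homomorphism, that is, $\varphi(f+ig)=S f+i\,S g$ for some linear lattice homomorphism $S:\mathrm{FBL}[E_{\mathbb R}]\to\mathbb R$. Then a functional $\varphi\in \mathrm{FBL}_{\mathbb C}[E]^*$ is a lattice homomorphism if and only if there is $z^*\in E^*$ such that $$\varphi(f+ig)=f(\mathfrak{Re}\,z^*)+i\,g(\mathfrak{Re}\,z^*)\qquad\text{for all } f+ig\in \mathrm{FBL}_{\mathbb C}[E].$$ -/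

import Mathlib

open scoped ENNReal

noncomputable section

section FreeNorm

variable {𝕜 E V : Type*} [RCLike 𝕜] [NormedAddCommGroup E] [NormedSpace 𝕜 E]
  [NormedAddCommGroup V]

/-- The tuple `x₁*, …, xₙ*` in the dual of `E` satisfies `sup_{z ∈ B_E} ∑ |xᵢ*(z)| ≤ 1`. -/
def IsAdmissible {n : ℕ} (x : Fin n → StrongDual 𝕜 E) : Prop :=
  ∀ z : E, ‖z‖ ≤ 1 → ∑ i, ‖x i z‖ ≤ 1

/-- The supremum of `∑ |f(xᵢ*)|` over all finite admissible tuples in `E*`, as a value in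
`[0, ∞]`. -/
def freeENorm (f : StrongDual 𝕜 E → V) : ℝ≥0∞ :=
  ⨆ (n : ℕ) (x : Fin n → StrongDual 𝕜 E) (_ : IsAdmissible x), ∑ i, ‖f (x i)‖ₑ

theorem sum_le_freeENorm (f : StrongDual 𝕜 E → V) {n : ℕ} {x : Fin n → StrongDual 𝕜 E}
    (hx : IsAdmissible x) : ∑ i, ‖f (x i)‖ₑ ≤ freeENorm f :=
  le_iSup_of_le n (le_iSup_of_le x (le_iSup_of_le hx le_rfl))

theorem freeENorm_le {f : StrongDual 𝕜 E → V} {C : ℝ≥0∞}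
    (h : ∀ (n : ℕ) (x : Fin n → StrongDual 𝕜 E), IsAdmissible x → ∑ i, ‖f (x i)‖ₑ ≤ C) :
    freeENorm f ≤ C :=
  iSup_le fun n => iSup_le fun x => iSup_le fun hx => h n x hx

theorem freeENorm_mono {W : Type*} [NormedAddCommGroup W] {f : StrongDual 𝕜 E → V}
    {g : StrongDual 𝕜 E → W} (h : ∀ x, ‖f x‖ ≤ ‖g x‖) : freeENorm f ≤ freeENorm g :=
  freeENorm_le fun _ x hx =>
    (Finset.sum_le_sum fun i _ => enorm_le_iff_norm_le.2 (h (x i))).trans (sum_le_freeENorm g hx)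

theorem freeENorm_add_le (f g : StrongDual 𝕜 E → V) :
    freeENorm (fun x => f x + g x) ≤ freeENorm f + freeENorm g := by
  refine freeENorm_le fun n x hx => ?_
  calc ∑ i, ‖f (x i) + g (x i)‖ₑ ≤ ∑ i, (‖f (x i)‖ₑ + ‖g (x i)‖ₑ) :=
        Finset.sum_le_sum fun i _ => enorm_add_le _ _
    _ = ∑ i, ‖f (x i)‖ₑ + ∑ i, ‖g (x i)‖ₑ := Finset.sum_add_distrib
    _ ≤ _ := add_le_add (sum_le_freeENorm f hx) (sum_le_freeENorm g hx)

theorem freeENorm_zero : freeENorm (fun _ : StrongDual 𝕜 E => (0 : V)) = 0 := by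
  simp [freeENorm]

theorem freeENorm_smul {𝕂 : Type*} [NormedField 𝕂] [NormedSpace 𝕂 V] (c : 𝕂)
    (f : StrongDual 𝕜 E → V) : freeENorm (fun x => c • f x) = ‖c‖ₑ * freeENorm f := by
  simp only [freeENorm, enorm_smul, ← Finset.mul_sum, ENNReal.mul_iSup]

theorem isAdmissible_single {x : StrongDual 𝕜 E} (hx : ‖x‖ ≤ 1) :
    IsAdmissible (fun _ : Fin 1 => x) := by
  intro z hz
  simp only [Finset.univ_unique, Finset.sum_const, Finset.card_singleton, one_smul]
  calc ‖x z‖ ≤ ‖x‖ * ‖z‖ := x.le_opNorm z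
    _ ≤ 1 := mul_le_one₀ hx (norm_nonneg _) hz

theorem eq_zero_of_freeENorm_eq_zero {f : StrongDual 𝕜 E → V} (h : freeENorm f = 0)
    {x : StrongDual 𝕜 E} (hx : ‖x‖ ≤ 1) : f x = 0 := by
  have := sum_le_freeENorm f (isAdmissible_single hx)
  simpa [h] using this

theorem freeENorm_eval_le (z : E) :
    freeENorm (fun x : StrongDual 𝕜 E => x z) ≤ ENNReal.ofReal ‖z‖ := by
  refine freeENorm_le fun n x hx => ?_
  have key : ∑ i, ‖x i z‖ ≤ ‖z‖ := by
    rcases eq_or_ne z 0 with rfl | hz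
    · simp
    · have hpos : 0 < ‖z‖ := norm_pos_iff.2 hz
      have h1 := hx (((‖z‖⁻¹ : ℝ) : 𝕜) • z) (by
        rw [norm_smul, RCLike.norm_ofReal, abs_of_pos (inv_pos.2 hpos),
          inv_mul_cancel₀ hpos.ne'])
      simp only [map_smul, norm_smul, RCLike.norm_ofReal, abs_of_pos (inv_pos.2 hpos),
        ← Finset.mul_sum] at h1
      rwa [inv_mul_le_iff₀ hpos, mul_one] at h1
  simp only [← ofReal_norm]
  rw [← ENNReal.ofReal_sum_of_nonneg fun i _ => norm_nonneg _]
  exact ENNReal.ofReal_le_ofReal key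

end FreeNorm

/-! ### The real free Banach lattice -/

section Real

/-- `H₁[F]`: the positively homogeneous functions `f : F* → ℝ` of finite free norm. -/
@[ext]
structure H1 (F : Type*) [NormedAddCommGroup F] [NormedSpace ℝ F] where
  toFun : StrongDual ℝ F → ℝ
  map_smul' : ∀ (c : ℝ) (x : StrongDual ℝ F), 0 ≤ c → toFun (c • x) = c * toFun x
  finite' : freeENorm toFun < ∞

namespace H1

variable {F : Type*} [NormedAddCommGroup F] [NormedSpace ℝ F]

instance : CoeFun (H1 F) fun _ => StrongDual ℝ F → ℝ := ⟨toFun⟩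

theorem toFun_injective : Function.Injective (toFun : H1 F → StrongDual ℝ F → ℝ) :=
  fun _ _ h => H1.ext h

theorem finite_smul (c : ℝ) (f : H1 F) : freeENorm (fun x => c * f x) < ∞ := by
  have := freeENorm_smul c f.toFun
  simp only [smul_eq_mul] at this
  rw [this]
  exact ENNReal.mul_lt_top enorm_lt_top f.finite'

theorem finite_add (f g : H1 F) : freeENorm (fun x => f x + g x) < ∞ :=
  (freeENorm_add_le _ _).trans_lt (ENNReal.add_lt_top.2 ⟨f.finite', g.finite'⟩)

theorem finite_abs_add (f g : H1 F) : freeENorm (fun x => |f x| + |g x|) < ∞ := by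
  refine (freeENorm_add_le _ _).trans_lt (ENNReal.add_lt_top.2 ⟨?_, ?_⟩)
  · exact (freeENorm_mono fun x => by simp).trans_lt f.finite'
  · exact (freeENorm_mono fun x => by simp).trans_lt g.finite'

instance : Zero (H1 F) := ⟨⟨fun _ => 0, by simp, by rw [freeENorm_zero]; simp⟩⟩

instance : Add (H1 F) :=
  ⟨fun f g => ⟨fun x => f x + g x,
    fun c x hc => by rw [f.map_smul' c x hc, g.map_smul' c x hc]; ring, finite_add f g⟩⟩

instance : SMul ℝ (H1 F) :=
  ⟨fun a f => ⟨fun x => a * f x,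
    fun c x hc => by rw [f.map_smul' c x hc]; ring, finite_smul a f⟩⟩

instance : SMul ℕ (H1 F) := ⟨fun n f => (n : ℝ) • f⟩

instance : SMul ℤ (H1 F) := ⟨fun n f => (n : ℝ) • f⟩

instance : Neg (H1 F) := ⟨fun f => (-1 : ℝ) • f⟩

instance : Sub (H1 F) := ⟨fun f g => f + -g⟩

instance : AddCommGroup (H1 F) :=
  toFun_injective.addCommGroup _ rfl (fun _ _ => rfl)
    (fun f => funext fun x => show (-1 : ℝ) * f x = - f x by ring)
    (fun f g => funext fun x => show f x + (-1 : ℝ) * g x = f x - g x by ring)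
    (fun f n => funext fun x => show (n : ℝ) * f x = n • f x by simp)
    (fun f n => funext fun x => show (n : ℝ) * f x = n • f x by simp)

/-- The inclusion of `H₁[F]` in the functions on `F*`, as an additive map. -/
def toFunHom : H1 F →+ (StrongDual ℝ F → ℝ) where
  toFun := H1.toFun
  map_zero' := rfl
  map_add' _ _ := rfl

instance : Module ℝ (H1 F) := toFun_injective.module ℝ toFunHom fun _ _ => rfl

/-- Pointwise order. -/
instance : PartialOrder (H1 F) := PartialOrder.lift toFun toFun_injective

/-- Pointwise lattice operations. -/
instance : Lattice (H1 F) where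
  sup f g := ⟨fun x => max (f x) (g x),
    fun c x hc => by rw [f.map_smul' c x hc, g.map_smul' c x hc, mul_max_of_nonneg _ _ hc],
    (freeENorm_mono fun x => by
      rw [Real.norm_eq_abs, Real.norm_eq_abs,
        abs_of_nonneg (add_nonneg (abs_nonneg (f x)) (abs_nonneg (g x)))]
      rcases max_choice (f x) (g x) with h | h <;> rw [h] <;>
        linarith [abs_nonneg (f x), abs_nonneg (g x)]).trans_lt (finite_abs_add f g)⟩
  inf f g := ⟨fun x => min (f x) (g x),
    fun c x hc => by rw [f.map_smul' c x hc, g.map_smul' c x hc, mul_min_of_nonneg _ _ hc],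
    (freeENorm_mono fun x => by
      rw [Real.norm_eq_abs, Real.norm_eq_abs,
        abs_of_nonneg (add_nonneg (abs_nonneg (f x)) (abs_nonneg (g x)))]
      rcases min_choice (f x) (g x) with h | h <;> rw [h] <;>
        linarith [abs_nonneg (f x), abs_nonneg (g x)]).trans_lt (finite_abs_add f g)⟩
  le_sup_left f g := fun x => le_max_left (f x) (g x)
  le_sup_right f g := fun x => le_max_right (f x) (g x)
  sup_le _ _ _ hf hg := fun x => max_le (hf x) (hg x)
  inf_le_left f g := fun x => min_le_left (f x) (g x)
  inf_le_right f g := fun x => min_le_right (f x) (g x)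
  le_inf _ _ _ hf hg := fun x => le_min (hf x) (hg x)

/-- The free norm on `H₁[F]`. -/
instance : Norm (H1 F) := ⟨fun f => (freeENorm f.toFun).toReal⟩

theorem eq_zero_of_freeENorm {f : H1 F} (h : freeENorm f.toFun = 0) : f = 0 := by
  refine H1.ext (funext fun x => ?_)
  have hn : 0 < ‖x‖ + 1 := by positivity
  have h1 : ‖(‖x‖ + 1)⁻¹ • x‖ ≤ 1 := by
    rw [norm_smul, Real.norm_eq_abs, abs_of_pos (inv_pos.2 hn), inv_mul_le_iff₀ hn]
    linarith
  have h2 := eq_zero_of_freeENorm_eq_zero h h1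
  rw [f.map_smul' _ _ (inv_nonneg.2 hn.le)] at h2
  exact (mul_eq_zero.1 h2).resolve_left (inv_ne_zero hn.ne')

theorem normCore : NormedSpace.Core ℝ (H1 F) where
  norm_nonneg _ := ENNReal.toReal_nonneg
  norm_smul c f := by
    change (freeENorm fun x => c • f x).toReal = _ * (freeENorm f.toFun).toReal
    rw [freeENorm_smul c f.toFun, ENNReal.toReal_mul, toReal_enorm]
  norm_triangle f g := by
    change (freeENorm fun x => f x + g x).toReal
      ≤ (freeENorm f.toFun).toReal + (freeENorm g.toFun).toReal
    rw [← ENNReal.toReal_add f.finite'.ne g.finite'.ne]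
    exact ENNReal.toReal_mono (ENNReal.add_lt_top.2 ⟨f.finite', g.finite'⟩).ne
      (freeENorm_add_le _ _)
  norm_eq_zero_iff f := by
    constructor
    · intro h
      refine eq_zero_of_freeENorm ?_
      exact ((ENNReal.toReal_eq_zero_iff _).1 h).resolve_right f.finite'.ne
    · rintro rfl
      change (freeENorm fun _ : StrongDual ℝ F => (0 : ℝ)).toReal = 0
      rw [freeENorm_zero, ENNReal.toReal_zero]

instance : NormedAddCommGroup (H1 F) := NormedAddCommGroup.ofCore normCore

instance : NormedSpace ℝ (H1 F) := NormedSpace.ofCore normCore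

/-- The evaluation function `δ_x : F* → ℝ`, `δ_x(x*) = x*(x)`. -/
def delta (x : F) : H1 F where
  toFun x' := x' x
  map_smul' c x' _ := by simp
  finite' := (freeENorm_eval_le (𝕜 := ℝ) x).trans_lt ENNReal.ofReal_lt_top

end H1

/-- `FBL[F]`: the closed sublattice of `H₁[F]` generated by the functions `δ_x`, `x ∈ F`, that is,
the smallest closed linear subspace that is stable under `⊔` (hence under `⊓`) and contains
every `δ_x`. -/
def FBL (F : Type*) [NormedAddCommGroup F] [NormedSpace ℝ F] : Submodule ℝ (H1 F) :=
  sInf {M | IsClosed (M : Set (H1 F)) ∧ (∀ f ∈ M, ∀ g ∈ M, f ⊔ g ∈ M) ∧ ∀ x, H1.delta x ∈ M}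

namespace FBL

variable {F : Type*} [NormedAddCommGroup F] [NormedSpace ℝ F]

theorem sup_mem {f g : H1 F} (hf : f ∈ FBL F) (hg : g ∈ FBL F) : f ⊔ g ∈ FBL F := by
  rw [FBL, Submodule.mem_sInf] at *
  exact fun M hM => hM.2.1 f (hf M hM) g (hg M hM)

theorem inf_mem {f g : H1 F} (hf : f ∈ FBL F) (hg : g ∈ FBL F) : f ⊓ g ∈ FBL F := by
  have h : f ⊓ g = f + g - f ⊔ g := by
    refine H1.ext (funext fun x => ?_)
    change min (f x) (g x) = (H1.toFunHom (f + g - f ⊔ g)) x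
    rw [map_sub, map_add]
    change _ = f x + g x - max (f x) (g x)
    linarith [min_add_max (f x) (g x)]
  rw [h]
  exact (FBL F).sub_mem ((FBL F).add_mem hf hg) (sup_mem hf hg)

/-- The lattice structure of `FBL[F]` inherited from `H₁[F]`, i.e. the pointwise one. -/
instance : Lattice (FBL F) :=
  Subtype.lattice (fun _ _ hf hg => sup_mem hf hg) fun _ _ hf hg => inf_mem hf hg

instance : CoeFun (FBL F) fun _ => StrongDual ℝ F → ℝ := ⟨fun f => f.1.toFun⟩

end FBL

end Real

/-! ### The complex free Banach lattice -/

section Complex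

variable {E : Type*} [NormedAddCommGroup E] [NormedSpace ℂ E]

/-- The real part `Re z*` of a complex functional `z*`, a functional on the underlying real
space of `E`. -/
def rePart (z : StrongDual ℂ E) : StrongDual ℝ E := Complex.reCLM ∘L z.restrictScalars ℝ

theorem rePart_surjective : Function.Surjective (rePart : StrongDual ℂ E → StrongDual ℝ E) := by
  intro x
  refine ⟨StrongDual.extendRCLike x, ?_⟩
  ext v
  simp [rePart, StrongDual.extendRCLike_apply]

theorem rePart_real_smul (c : ℝ) (z : StrongDual ℂ E) :
    rePart ((c : ℂ) • z) = c • rePart z := by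
  ext v
  simp [rePart]

theorem IsAdmissible.rePart {n : ℕ} {z : Fin n → StrongDual ℂ E} (hz : IsAdmissible z) :
    IsAdmissible fun i => rePart (z i) := fun v hv =>
  (Finset.sum_le_sum fun i _ => Complex.abs_re_le_norm (z i v)).trans (hz v hv)

/-- `FBL_ℂ[E] = FBL[E_ℝ] ⊕ i FBL[E_ℝ]`, where `E_ℝ` is `E` regarded as a real space; `⟨f, g⟩`
stands for `f + i g`. -/
@[ext]
structure FBLC (E : Type*) [NormedAddCommGroup E] [NormedSpace ℂ E] where
  re : FBL E
  im : FBL E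

namespace FBLC

/-- The complex function `x* ↦ f(x*) + i g(x*)` on `(E_ℝ)*` given by `f + i g`. -/
def eval (h : FBLC E) (x : StrongDual ℝ E) : ℂ := (h.re x : ℂ) + Complex.I * (h.im x : ℂ)

instance : Zero (FBLC E) := ⟨⟨0, 0⟩⟩

instance : Add (FBLC E) := ⟨fun h k => ⟨h.re + k.re, h.im + k.im⟩⟩

instance : Neg (FBLC E) := ⟨fun h => ⟨-h.re, -h.im⟩⟩

instance : Sub (FBLC E) := ⟨fun h k => ⟨h.re - k.re, h.im - k.im⟩⟩

instance : SMul ℕ (FBLC E) := ⟨fun n h => ⟨n • h.re, n • h.im⟩⟩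

instance : SMul ℤ (FBLC E) := ⟨fun n h => ⟨n • h.re, n • h.im⟩⟩

theorem pair_injective : Function.Injective fun h : FBLC E => (h.re, h.im) := by
  rintro ⟨a, b⟩ ⟨c, d⟩ h
  simpa using h

instance : AddCommGroup (FBLC E) :=
  pair_injective.addCommGroup _ rfl (fun _ _ => rfl) (fun _ => rfl) (fun _ _ => rfl)
    (fun _ _ => rfl) (fun _ _ => rfl)

/-- `(a + i b)(f + i g) = (a f - b g) + i (b f + a g)`. -/
instance : SMul ℂ (FBLC E) :=
  ⟨fun c h => ⟨c.re • h.re - c.im • h.im, c.im • h.re + c.re • h.im⟩⟩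

@[simp] theorem zero_re : (0 : FBLC E).re = 0 := rfl
@[simp] theorem zero_im : (0 : FBLC E).im = 0 := rfl
@[simp] theorem add_re (h k : FBLC E) : (h + k).re = h.re + k.re := rfl
@[simp] theorem add_im (h k : FBLC E) : (h + k).im = h.im + k.im := rfl
@[simp] theorem smul_re (c : ℂ) (h : FBLC E) : (c • h).re = c.re • h.re - c.im • h.im := rfl
@[simp] theorem smul_im (c : ℂ) (h : FBLC E) : (c • h).im = c.im • h.re + c.re • h.im := rfl

instance : Module ℂ (FBLC E) where
  one_smul h := by ext1 <;> simp
  mul_smul c d h := by ext1 <;> simp <;> module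
  smul_zero c := by ext1 <;> simp
  smul_add c h k := by ext1 <;> simp <;> module
  add_smul c d h := by ext1 <;> simp <;> module
  zero_smul h := by ext1 <;> simp

/-- The norm `‖f + i g‖ = sup ∑ |(f + i g)(Re z_j*)|`, over all finite tuples in the complex dual
`E*` with `sup_{z ∈ B_E} ∑ |z_j*(z)| ≤ 1`. The supremum is finite by `freeENorm_lt_top`. -/
instance : Norm (FBLC E) :=
  ⟨fun h => (freeENorm fun z : StrongDual ℂ E => h.eval (rePart z)).toReal⟩

theorem freeENorm_rePart_le {V : Type*} [NormedAddCommGroup V] (f : StrongDual ℝ E → V) :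
    freeENorm (fun z : StrongDual ℂ E => f (rePart z)) ≤ freeENorm f :=
  freeENorm_le fun _ _ hz => sum_le_freeENorm f hz.rePart

theorem freeENorm_lt_top (h : FBLC E) :
    freeENorm (fun z : StrongDual ℂ E => h.eval (rePart z)) < ∞ := by
  refine (freeENorm_rePart_le h.eval).trans_lt ?_
  refine (freeENorm_mono fun x => ?_).trans_lt (H1.finite_abs_add h.re.1 h.im.1)
  calc ‖h.eval x‖ ≤ ‖(h.re x : ℂ)‖ + ‖Complex.I * (h.im x : ℂ)‖ := norm_add_le _ _
    _ = |h.re x| + |h.im x| := by simp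
    _ ≤ ‖|h.re x| + |h.im x|‖ := le_abs_self _

theorem eval_add (h k : FBLC E) (x : StrongDual ℝ E) : (h + k).eval x = h.eval x + k.eval x := by
  change ((h.re x + k.re x : ℝ) : ℂ) + Complex.I * ((h.im x + k.im x : ℝ) : ℂ) = _
  simp only [eval]
  push_cast
  ring

theorem eval_smul (c : ℂ) (h : FBLC E) (x : StrongDual ℝ E) : (c • h).eval x = c • h.eval x := by
  have h1 : (c • h).re x = c.re * h.re x - c.im * h.im x := by
    change H1.toFunHom (c.re • h.re.1 - c.im • h.im.1) x = _
    rw [map_sub]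
    rfl
  have h2 : (c • h).im x = c.im * h.re x + c.re * h.im x := rfl
  simp only [eval]
  rw [h1, h2]
  apply Complex.ext <;> simp <;> ring

theorem normCore : NormedSpace.Core ℂ (FBLC E) where
  norm_nonneg _ := ENNReal.toReal_nonneg
  norm_smul c h := by
    change (freeENorm fun z : StrongDual ℂ E => (c • h).eval (rePart z)).toReal =
      _ * (freeENorm fun z : StrongDual ℂ E => h.eval (rePart z)).toReal
    simp only [eval_smul]
    rw [freeENorm_smul c fun z : StrongDual ℂ E => h.eval (rePart z), ENNReal.toReal_mul,
      toReal_enorm]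
  norm_triangle h k := by
    change (freeENorm fun z : StrongDual ℂ E => (h + k).eval (rePart z)).toReal ≤
      (freeENorm fun z : StrongDual ℂ E => h.eval (rePart z)).toReal +
      (freeENorm fun z : StrongDual ℂ E => k.eval (rePart z)).toReal
    simp only [eval_add]
    rw [← ENNReal.toReal_add h.freeENorm_lt_top.ne k.freeENorm_lt_top.ne]
    exact ENNReal.toReal_mono
      (ENNReal.add_lt_top.2 ⟨h.freeENorm_lt_top, k.freeENorm_lt_top⟩).ne (freeENorm_add_le _ _)
  norm_eq_zero_iff h := by
    constructor
    · intro h0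
      have h1 : freeENorm (fun z : StrongDual ℂ E => h.eval (rePart z)) = 0 :=
        ((ENNReal.toReal_eq_zero_iff _).1 h0).resolve_right h.freeENorm_lt_top.ne
      have key : ∀ x : StrongDual ℝ E, h.eval x = 0 := by
        intro x
        obtain ⟨z, rfl⟩ := rePart_surjective x
        have hn : 0 < ‖z‖ + 1 := by positivity
        have h2 : ‖(((‖z‖ + 1)⁻¹ : ℝ) : ℂ) • z‖ ≤ 1 := by
          rw [norm_smul, Complex.norm_real, Real.norm_eq_abs, abs_of_pos (inv_pos.2 hn),
            inv_mul_le_iff₀ hn]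
          linarith
        have h3 := eq_zero_of_freeENorm_eq_zero h1 h2
        simp only [rePart_real_smul, eval] at h3
        rw [h.re.1.map_smul' _ _ (inv_nonneg.2 hn.le),
          h.im.1.map_smul' _ _ (inv_nonneg.2 hn.le)] at h3
        have hc : (((‖z‖ + 1)⁻¹ : ℝ) : ℂ) ≠ 0 := by exact_mod_cast (inv_ne_zero hn.ne')
        refine (mul_eq_zero.1 (?_ : (((‖z‖ + 1)⁻¹ : ℝ) : ℂ) * h.eval (rePart z) = 0)).resolve_left hc
        rw [← h3, eval, Complex.ofReal_mul, Complex.ofReal_mul]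
        ring
      apply FBLC.ext
      · refine Subtype.ext (H1.ext (funext fun x => ?_))
        have := congrArg Complex.re (key x)
        refine Eq.trans ?_ (this.trans rfl)
        simp [eval]
      · refine Subtype.ext (H1.ext (funext fun x => ?_))
        have := congrArg Complex.im (key x)
        refine Eq.trans ?_ (this.trans rfl)
        simp [eval]
    · rintro rfl
      change (freeENorm fun z : StrongDual ℂ E => (0 : FBLC E).eval (rePart z)).toReal = 0
      have h0 : ∀ x : StrongDual ℝ E, (0 : FBLC E).eval x = 0 := fun x => by
        change (((0 : ℝ) : ℂ) + Complex.I * ((0 : ℝ) : ℂ)) = 0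
        simp
      simp only [h0]
      rw [freeENorm_zero, ENNReal.toReal_zero]

instance : NormedAddCommGroup (FBLC E) := NormedAddCommGroup.ofCore normCore

instance : NormedSpace ℂ (FBLC E) := NormedSpace.ofCore normCore

/-- A functional `φ ∈ FBL_ℂ[E]*` is a lattice homomorphism if it is the complexification
`φ(f + i g) = S f + i S g` of a real lattice homomorphism `S : FBL[E_ℝ] → ℝ`, i.e. of a linear
map `S` preserving `⊔` and `⊓` (such an `S` is bounded because `φ` is). -/
def IsLatticeHom (φ : StrongDual ℂ (FBLC E)) : Prop :=
  ∃ S : FBL E →ₗ[ℝ] ℝ,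
    (∀ f g : FBL E, S (f ⊔ g) = S f ⊔ S g) ∧ (∀ f g : FBL E, S (f ⊓ g) = S f ⊓ S g) ∧
    ∀ f g : FBL E, φ ⟨f, g⟩ = (S f : ℂ) + Complex.I * (S g : ℂ)

end FBLC

end Complex

end

/-!
The evaluations `f ↦ f(x*)` are lattice homomorphisms. Conversely, if `S` is a bounded real lattice
homomorphism on `FBL[F]`, then `x*(x) = S δ_x` defines a functional in `F*`, and `S` agrees with the
evaluation at `x*` on every `δ_x`, hence on the closed sublattice they generate. A complex lattice
homomorphism `φ` is the complexification of a real one, which is bounded because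
`f ↦ f + i 0` is; and every real functional on `E_ℝ` is `Re z*` for some `z* ∈ E*`.
-/

namespace H1

variable {F : Type*} [NormedAddCommGroup F] [NormedSpace ℝ F]

theorem abs_apply_le_norm (f : H1 F) {x : StrongDual ℝ F} (hx : ‖x‖ ≤ 1) : |f x| ≤ ‖f‖ := by
  have h := sum_le_freeENorm f.toFun (isAdmissible_single hx)
  rw [Fin.sum_univ_one] at h
  calc |f x| = ‖f x‖ₑ.toReal := by rw [toReal_enorm, Real.norm_eq_abs]
    _ ≤ ‖f‖ := ENNReal.toReal_mono f.finite'.ne h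

theorem abs_apply_le (f : H1 F) (x : StrongDual ℝ F) : |f x| ≤ ‖x‖ * ‖f‖ := by
  have hx : ‖‖x‖⁻¹ • x‖ ≤ 1 := by
    rw [norm_smul, norm_inv, norm_norm]
    exact inv_mul_le_one
  calc |f x| = |f (‖x‖ • ‖x‖⁻¹ • x)| := by
        rw [← NormedSpace.normalize, NormedSpace.norm_smul_normalize]
    _ = ‖x‖ * |f (‖x‖⁻¹ • x)| := by
        rw [f.map_smul' _ _ (norm_nonneg x), abs_mul, abs_norm]
    _ ≤ ‖x‖ * ‖f‖ := by gcongr; exact f.abs_apply_le_norm hx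

theorem norm_delta_le (x : F) : ‖delta x‖ ≤ ‖x‖ :=
  ENNReal.toReal_le_of_le_ofReal (norm_nonneg x) (freeENorm_eval_le (𝕜 := ℝ) x)

/-- Evaluation at `x ∈ F*`, as a continuous linear functional on `H₁[F]`. -/
noncomputable def evalCLM (x : StrongDual ℝ F) : StrongDual ℝ (H1 F) :=
  LinearMap.mkContinuous
    { toFun := fun f => f x
      map_add' := fun _ _ => rfl
      map_smul' := fun _ _ => rfl } ‖x‖ fun f => f.abs_apply_le x

end H1

namespace FBL

variable {F : Type*} [NormedAddCommGroup F] [NormedSpace ℝ F]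

theorem delta_mem (x : F) : H1.delta x ∈ FBL F :=
  Submodule.mem_sInf.2 fun _ hM => hM.2.2 x

theorem isClosed : IsClosed (FBL F : Set (H1 F)) := by
  rw [FBL, Submodule.coe_sInf]
  exact isClosed_biInter fun _ hM => hM.1

/-- The canonical map `x ↦ δ_x` from `F` to `FBL[F]`, as a continuous linear map. -/
noncomputable def deltaCLM : F →L[ℝ] FBL F :=
  LinearMap.mkContinuous
    { toFun := fun x => ⟨H1.delta x, delta_mem x⟩
      map_add' := fun x y => Subtype.ext (H1.ext (funext fun z => map_add z x y))
      map_smul' := fun c x => Subtype.ext (H1.ext (funext fun z => map_smul z c x)) } 1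
    fun x => (H1.norm_delta_le x).trans_eq (one_mul _).symm

/-- Evaluation at `x ∈ F*`, as a continuous linear functional on `FBL[F]`. -/
noncomputable def evalCLM (x : StrongDual ℝ F) : StrongDual ℝ (FBL F) :=
  H1.evalCLM x ∘L (FBL F).subtypeL

theorem eq_top_of_isClosed_of_sup_mem {M : Submodule ℝ (FBL F)}
    (hclosed : IsClosed (M : Set (FBL F))) (hsup : ∀ f ∈ M, ∀ g ∈ M, f ⊔ g ∈ M)
    (hdelta : ∀ x, deltaCLM x ∈ M) : M = ⊤ := by
  have hle : FBL F ≤ M.map (FBL F).subtype := by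
    refine sInf_le ⟨?_, ?_, fun x => ⟨deltaCLM x, hdelta x, rfl⟩⟩
    · exact isClosed.isClosedEmbedding_subtypeVal.isClosedMap _ hclosed
    · rintro _ ⟨f, hf, rfl⟩ _ ⟨g, hg, rfl⟩
      exact ⟨f ⊔ g, hsup f hf g hg, rfl⟩
  refine Submodule.eq_top_iff'.2 fun f => ?_
  obtain ⟨g, hg, hgf⟩ := hle f.2
  rwa [← Subtype.ext hgf]

theorem continuousLinearMap_ext_of_map_sup {X : Type*} [AddCommMonoid X] [Module ℝ X]
    [TopologicalSpace X] [T2Space X] [Max X] {S T : FBL F →L[ℝ] X}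
    (hS : ∀ f g, S (f ⊔ g) = S f ⊔ S g) (hT : ∀ f g, T (f ⊔ g) = T f ⊔ T g)
    (hdelta : S ∘L deltaCLM = T ∘L deltaCLM) : S = T := by
  have htop : LinearMap.eqLocus S.toLinearMap T.toLinearMap = ⊤ := by
    refine eq_top_of_isClosed_of_sup_mem (isClosed_eq S.continuous T.continuous) ?_
      fun x => DFunLike.congr_fun hdelta x
    intro f (hf : S f = T f) g (hg : S g = T g)
    change S (f ⊔ g) = T (f ⊔ g)
    rw [hS, hT, hf, hg]
  exact ContinuousLinearMap.coe_injective (LinearMap.eqLocus_eq_top.1 htop)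

theorem eq_evalCLM_of_map_sup {S : StrongDual ℝ (FBL F)} (hS : ∀ f g, S (f ⊔ g) = S f ⊔ S g) :
    S = evalCLM (S ∘L deltaCLM) :=
  continuousLinearMap_ext_of_map_sup hS (fun _ _ => rfl) rfl

end FBL

namespace FBLC

variable {E : Type*} [NormedAddCommGroup E] [NormedSpace ℂ E]

theorem norm_mk_zero_le (f : FBL E) : ‖(⟨f, 0⟩ : FBLC E)‖ ≤ ‖f‖ := by
  refine ENNReal.toReal_mono f.1.finite'.ne
    ((freeENorm_mono fun z => ?_).trans (freeENorm_rePart_le (E := E) f.1.toFun))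
  change ‖((f (rePart z) : ℝ) : ℂ) + Complex.I * ((0 : ℝ) : ℂ)‖ ≤ ‖f (rePart z)‖
  simp

/-- The inclusion `f ↦ f + i 0` of `FBL[E_ℝ]` in `FBL_ℂ[E]`, as a continuous real-linear map. It is
contractive but need not be isometric, since the norm of `FBL_ℂ[E]` has fewer admissible tuples. -/
noncomputable def ofRealCLM : FBL E →L[ℝ] FBLC E :=
  LinearMap.mkContinuous
    { toFun := fun f => ⟨f, 0⟩
      map_add' := fun f g => by ext1 <;> simp
      map_smul' := fun c f => by
        change _ = (c : ℂ) • (⟨f, 0⟩ : FBLC E)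
        ext1 <;> simp [-Complex.coe_smul] } 1
    fun f => (norm_mk_zero_le f).trans_eq (one_mul _).symm

theorem IsLatticeHom.exists_strongDual {φ : StrongDual ℂ (FBLC E)} (hφ : IsLatticeHom φ) :
    ∃ S : StrongDual ℝ (FBL E), (∀ f g, S (f ⊔ g) = S f ⊔ S g) ∧
      ∀ h : FBLC E, φ h = (S h.re : ℂ) + Complex.I * (S h.im : ℂ) := by
  obtain ⟨S, hsup, -, hφS⟩ := hφ
  let T : StrongDual ℝ (FBL E) := Complex.reCLM ∘L φ.restrictScalars ℝ ∘L ofRealCLM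
  have hTS (f : FBL E) : T f = S f := by
    change (φ ⟨f, 0⟩).re = S f
    simp [hφS]
  exact ⟨T, fun f g => by simp only [hTS, hsup], fun h => by simpa only [hTS] using hφS h.re h.im⟩

theorem isLatticeHom_iff_exists_eval {φ : StrongDual ℂ (FBLC E)} :
    IsLatticeHom φ ↔ ∃ x : StrongDual ℝ E, ∀ h, φ h = h.eval x := by
  constructor
  · intro hφ
    obtain ⟨S, hsup, hφS⟩ := hφ.exists_strongDual
    have hS (f : FBL E) : S f = f (S ∘L FBL.deltaCLM) :=
      DFunLike.congr_fun (FBL.eq_evalCLM_of_map_sup hsup) f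
    exact ⟨S ∘L FBL.deltaCLM, fun h => by rw [hφS, hS, hS, eval]⟩
  · rintro ⟨x, hx⟩
    exact ⟨(FBL.evalCLM x).toLinearMap, fun _ _ => rfl, fun _ _ => rfl, fun f g => hx ⟨f, g⟩⟩

end FBLC

theorem mainTheorem10_general {E : Type*} [NormedAddCommGroup E] [NormedSpace ℂ E]
    (φ : StrongDual ℂ (FBLC E)) :
    FBLC.IsLatticeHom φ ↔
      ∃ z : StrongDual ℂ E, ∀ f g : FBL E,
        φ ⟨f, g⟩ = (f (rePart z) : ℂ) + Complex.I * (g (rePart z) : ℂ) := by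
  rw [FBLC.isLatticeHom_iff_exists_eval, rePart_surjective.exists]
  exact exists_congr fun z => ⟨fun h f g => h ⟨f, g⟩, fun h k => h k.re k.im⟩

theorem mainTheorem10 {E : Type*} [NormedAddCommGroup E] [NormedSpace ℂ E] [CompleteSpace E]
    (φ : StrongDual ℂ (FBLC E)) :
    FBLC.IsLatticeHom φ ↔
      ∃ z : StrongDual ℂ E, ∀ f g : FBL E,
        φ ⟨f, g⟩ = (f (rePart z) : ℂ) + Complex.I * (g (rePart z) : ℂ) :=
  mainTheorem10_general φ
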